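/- Let $\mathbb T^2$ be the torus with normalized Haar measure $\sigma$, let $H^2(\mathbb D^2)$ be the closure of the polynomials in $z_1,z_2$ in $L^2(\mathbb T^2)=L^2(\mathbb T^2,\sigma)$, and let $P$ be the orthogonal projection of $L^2(\mathbb T^2)$ onto $H^2(\mathbb D^2)$. For $f\in L^\infty(\mathbb T^2)$ let $T_f$ be the Toeplitz operator on $H^2(\mathbb D^2)$ given by $T_f h=P(fh)$. Call a function $f\in L^\infty(\mathbb T^2)$ analytic if $f\in H^2(\mathbb D^2)$, that is, if $f$ is the boundary function of a bounded analytic function on the bidisc $\mathbb D^2$. Let $f,g\in L^\infty(\mathbb T^2)$ and suppose that at least one of the functions $f,\bar f,g,\bar g$ is analytic. Then the commutator $T_fT_g-T_gT_f$ is zero if and only if it is a compact operator on $H^2(\mathbb D^2)$. -/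

import Mathlib

open MeasureTheory
open scoped ENNReal

noncomputable section

namespace Bidisc

/-- The bitorus `T²`, as `(ℝ/ℤ)²`; the point `t` stands for `(e^{2πi t₀}, e^{2πi t₁})`. -/
abbrev Torus : Type := UnitAddTorus (Fin 2)

/-- Normalized Haar measure on the bitorus: the product of the normalized Haar measures of the
two circles. -/
abbrev σ : Measure Torus := Measure.pi fun _ : Fin 2 => (AddCircle.haarAddCircle (T := (1 : ℝ)))

/-- `L²(T²)`. -/
abbrev L2 : Type := Lp ℂ 2 σ

/-- `L^∞(T²)`, the (essentially) bounded symbols. Complex conjugation is `star`. -/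
abbrev LInf : Type := Lp ℂ ∞ σ

/-- The monomial `z₁^{m₁} z₂^{m₂}` on the bitorus, with nonnegative integer exponents. -/
def monomialFun (m : Fin 2 → ℕ) : C(Torus, ℂ) :=
  UnitAddTorus.mFourier fun i => (m i : ℤ)

/-- The monomial `z₁^{m₁} z₂^{m₂}` as an element of `L²(T²)`. -/
def monomialL2 (m : Fin 2 → ℕ) : L2 :=
  ContinuousMap.toLp (E := ℂ) 2 σ ℂ (monomialFun m)

/-- The Hardy space `H²(D²)`: the closure in `L²(T²)` of the analytic polynomials. -/
def H2 : Submodule ℂ L2 :=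
  (Submodule.span ℂ (Set.range monomialL2)).topologicalClosure

instance instCompleteSpaceH2 : CompleteSpace H2 :=
  (Submodule.isClosed_topologicalClosure _).completeSpace_coe

/-- Multiplication by `f ∈ L^∞(T²)` as a bounded operator on `L²(T²)`. -/
def mulOp (f : LInf) : L2 →L[ℂ] L2 :=
  (ContinuousLinearMap.mul ℂ ℂ).holderL σ ∞ 2 2 f

/-- `mulOp f` is pointwise multiplication by `f`. -/
theorem coeFn_mulOp (f : LInf) (h : L2) : mulOp f h =ᵐ[σ] fun t => f t * h t :=
  (ContinuousLinearMap.mul ℂ ℂ).coeFn_holder f h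

/-- The Toeplitz operator `T_f h = P (f h)` on `H²(D²)`, with `P` the orthogonal projection of
`L²(T²)` onto `H²(D²)`. -/
def toeplitz (f : LInf) : H2 →L[ℂ] H2 :=
  H2.orthogonalProjectionOnto ∘L mulOp f ∘L H2.subtypeL

/-- A bounded function on the bitorus is analytic (that is, it is the boundary function of a
bounded analytic function on the bidisc) if it lies in `H^∞ = L^∞(T²) ∩ H²(D²)`. -/
def IsAnalytic (f : LInf) : Prop :=
  ((Lp.memLp f).mono_exponent le_top : MemLp f 2 σ).toLp f ∈ H2

end Bidisc

end

/-!
Compactness enters only through matrix entries. In the basis of monomials `z^p`, `p ∈ ℕ²`, of the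
Hardy space, the commutator has the entries
`∑_{l ∈ ℕ²} (a(p - l) b(l - q) - b(p - l) a(l - q))`, where `a`, `b` are the Fourier coefficients of
`f`, `g`. If the commutator is compact, its entries at `(p + k e, q + k e)` tend to `0` as `k → ∞`,
for `e = (1, 0)` and `e = (0, 1)`, since the monomials involved form orthonormal sequences
(`diagonalDecay_of_isCompactOperator`). This property of the entries is preserved by taking adjoints
and by exchanging the symbols, so one may assume that `f` is analytic, that is, that `a` lives on
`ℕ²`.

Then the `(p, q)` entry is `-∑_{l ∉ ℕ²} a(p - l) b(l - q)` (`commutatorEntry_eq_neg_tsum`).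
Replacing `(p, q)` by `(p + (k, 1), q + (k, 1))` and subtracting the entry for
`(p + (k, 0), q + (k, 0))` leaves the sum over the half row `l₂ = -1`, `l₁ ≥ -k`. For `k → ∞` the
differences tend to `0` and the half rows fill up the row, so the sum over the whole row `l₂ = -1`
vanishes (`tsum_row_eq_zero`). As `p` and `q` vary, this says that each of the functions
`f_i(z₁) = ∑_m a(m, i) z₁^m`, `i > 0`, has product zero with each
`g_j(z₁) = ∑_m b(m, j) z₁^m`, `j < 0`.

A nonzero function of the Hardy space of the circle does not vanish on a set of positive measure
(`eq_zero_or_eq_zero_of_convolution_eq_zero`, proved by the shift-invariant subspace argument in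
`ℓ²(ℤ)`). Hence all `f_i`, `i > 0`, vanish or all `g_j`, `j < 0`, vanish: in the variable `z₂`,
either `f` is constant or `g` is analytic. The same alternative holds in `z₁`. Every `l ∉ ℕ²` has a
negative coordinate, and the alternative for that coordinate gives `a(p - l) b(l - q) = 0`; so all
entries are `0`.
-/

noncomputable section

namespace Bidisc

open Filter Topology

/-! ### Translates in `ℓ²(ℤ)` and the zero sets of Hardy space functions -/

theorem memℓp_two_of_summable {ι : Type*} {x : ι → ℂ} (h : Summable fun n => ‖x n‖ ^ 2) :
    Memℓp x 2 := by
  rw [memℓp_gen_iff (by norm_num)]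
  simpa using h

theorem summable_norm_sq {ι : Type*} (x : lp (fun _ : ι => ℂ) 2) :
    Summable fun n => ‖x n‖ ^ 2 := by
  simpa using (lp.memℓp x).summable (by norm_num)

/-- The translation `(x_n) ↦ (x_{n-k})` on `ℓ²(ℤ)`; under Fourier series it is multiplication by
`z ^ k` on `L²` of the circle. -/
def translate (k : ℤ) : lp (fun _ : ℤ => ℂ) 2 →ₗᵢ[ℂ] lp (fun _ : ℤ => ℂ) 2 where
  toFun x := ⟨fun n => x (n - k), 
    memℓp_two_of_summable ((Equiv.subRight k).summable_iff.2 (summable_norm_sq x))⟩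
  map_add' x y := by ext n; rfl
  map_smul' c x := by ext n; rfl
  norm_map' x := by
    simp only [lp.norm_eq_tsum_rpow (p := 2) (by norm_num)]
    congr 1
    exact (Equiv.subRight k).tsum_eq (fun n => ‖x n‖ ^ (2 : ℝ≥0∞).toReal)

@[simp]
theorem translate_apply (k : ℤ) (x : lp (fun _ : ℤ => ℂ) 2) (n : ℤ) :
    translate k x n = x (n - k) := rfl

theorem translate_translate (j k : ℤ) (x : lp (fun _ : ℤ => ℂ) 2) :
    translate j (translate k x) = translate (j + k) x := by
  ext n
  simp [sub_sub]

theorem translate_zero (x : lp (fun _ : ℤ => ℂ) 2) : translate 0 x = x := by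
  ext n
  simp

theorem inner_translate_translate (j k : ℤ) (x y : lp (fun _ : ℤ => ℂ) 2) :
    inner ℂ (translate j x) (translate k y) = inner ℂ (translate (j - k) x) y := by
  rw [← (translate k).inner_map_map (translate (j - k) x) y, translate_translate,
    add_sub_cancel]

/-- If the translates of a unit vector of `ℓ²(ℤ)` are orthonormal, they are complete: each unit
coordinate vector `δ_m` has the coefficients `conj (h (m - k))`, whose squares already add up to
`1`, so equality holds in Bessel's inequality. -/
theorem eq_zero_of_inner_translate_eq_zero {h v : lp (fun _ : ℤ => ℂ) 2}
    (ho : Orthonormal ℂ fun k : ℤ => translate k h)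
    (hv : ∀ k : ℤ, inner ℂ v (translate k h) = 0) : v = 0 := by
  ext m
  set e : lp (fun _ : ℤ => ℂ) 2 := lp.single 2 m (1 : ℂ) with he
  have he1 : ‖e‖ = 1 := by simp [he, lp.norm_single]
  have hcoef (k : ℤ) : ‖inner ℂ (translate k h) e‖ ^ 2 = ‖h (m - k)‖ ^ 2 := by
    rw [he, lp.inner_single_right]
    simp
  have hh : HasSum (fun n : ℤ => ‖h n‖ ^ 2) 1 := by
    have h1 : ‖h‖ = 1 := by simpa [translate_zero] using ho.1 0
    have := lp.hasSum_norm (p := 2) (by norm_num) h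
    simpa [h1] using this
  have hsum : HasSum (fun k : ℤ => ‖inner ℂ (translate k h) e‖ ^ 2) 1 := by
    simp only [hcoef]
    exact (Equiv.subLeft m).hasSum_iff.2 hh
  have hbound (s : Finset ℤ) :
      ‖inner ℂ v e‖ ^ 2 ≤ ‖v‖ ^ 2 * (1 - ∑ k ∈ s, ‖inner ℂ (translate k h) e‖ ^ 2) := by
    set y := e - ∑ k ∈ s, inner ℂ (translate k h) e • translate k h with hy
    have h1 : inner ℂ v y = inner ℂ v e := by
      rw [hy, inner_sub_right, inner_sum,
        Finset.sum_eq_zero fun k _ => by rw [inner_smul_right, hv, mul_zero], sub_zero]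
    have h2 : ‖y‖ ^ 2 = 1 - ∑ k ∈ s, ‖inner ℂ (translate k h) e‖ ^ 2 := by
      have h3 : inner ℂ (∑ k ∈ s, inner ℂ (translate k h) e • translate k h) y = 0 := by
        rw [sum_inner]
        refine Finset.sum_eq_zero fun k hk => ?_
        rw [inner_smul_left, hy, inner_sub_right,
          ho.inner_right_sum (fun k => inner ℂ (translate k h) e) hk, sub_self, mul_zero]
      have h4 : inner ℂ y y = inner ℂ e y := by
        nth_rw 1 [hy]
        rw [inner_sub_left, h3, sub_zero]
      have h5 : inner ℂ e y = 1 - ∑ k ∈ s, ((‖inner ℂ (translate k h) e‖ : ℂ)) ^ 2 := by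
        rw [hy, inner_sub_right, inner_sum, inner_self_eq_norm_sq_to_K, he1]
        congr 1
        · simp
        · refine Finset.sum_congr rfl fun k _ => ?_
          rw [inner_smul_right, ← inner_conj_symm e, RCLike.mul_conj]
          rfl
      rw [h5, inner_self_eq_norm_sq_to_K] at h4
      apply Complex.ofReal_injective
      push_cast
      exact h4
    rw [← h1, ← h2, ← mul_pow]
    exact pow_le_pow_left₀ (norm_nonneg _) (norm_inner_le_norm _ _) 2
  have hlim : Tendsto
      (fun s : Finset ℤ => ‖v‖ ^ 2 * (1 - ∑ k ∈ s, ‖inner ℂ (translate k h) e‖ ^ 2))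
      atTop (𝓝 0) := by
    have := (tendsto_const_nhds (x := (1 : ℝ))).sub hsum
    simpa using this.const_mul (‖v‖ ^ 2)
  have h0 : inner ℂ v e = 0 := by
    have := ge_of_tendsto' hlim hbound
    exact norm_eq_zero.1 (pow_eq_zero_iff two_ne_zero |>.1 (le_antisymm this (sq_nonneg _)))
  rw [he, lp.inner_single_right] at h0
  simpa using h0

/-- A nonzero one-sided sequence `u`, that is, a nonzero function of the Hardy space of the circle,
is cyclic for the bilateral shift. With `M` the closed span of the translates `z ^ k u`, `k ≥ 1`,
the component of `u` orthogonal to `M` is a nonzero function of constant modulus, so that its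
translates form an orthogonal basis. -/
theorem eq_zero_of_inner_translate_oneSided {u v : lp (fun _ : ℤ => ℂ) 2}
    (hu : ∀ n < 0, u n = 0) (hu0 : u ≠ 0)
    (hv : ∀ k : ℤ, inner ℂ v (translate k u) = 0) : v = 0 := by
  obtain ⟨n₀, hn₀, hmin⟩ : ∃ n₀ : ℤ, u n₀ ≠ 0 ∧ ∀ n, u n ≠ 0 → n₀ ≤ n := by
    refine Int.exists_least_of_bdd ⟨0, fun n hn => not_lt.1 fun h => hn (hu n h)⟩ ?_
    by_contra! hc
    exact hu0 (by ext n; exact hc n)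
  have hlow (n : ℤ) (hn : n < n₀) : u n = 0 := by
    by_contra hc
    exact absurd (hmin n hc) (not_le.2 hn)
  set M : Submodule ℂ (lp (fun _ : ℤ => ℂ) 2) :=
    (Submodule.span ℂ (Set.range fun k : ℕ => translate (k + 1) u)).topologicalClosure with hM
  have hMcl : IsClosed (M : Set (lp (fun _ : ℤ => ℂ) 2)) := Submodule.isClosed_topologicalClosure _
  have : CompleteSpace M := hMcl.completeSpace_coe
  -- A closed subspace contains `M` as soon as it contains the generators.
  have hMle (N : Submodule ℂ (lp (fun _ : ℤ => ℂ) 2))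
      (hN : IsClosed (N : Set (lp (fun _ : ℤ => ℂ) 2)))
      (h : ∀ k : ℕ, translate (k + 1) u ∈ N) : M ≤ N :=
    Submodule.topologicalClosure_minimal _ (Submodule.span_le.2 (by rintro _ ⟨k, rfl⟩; exact h k)) hN
  have hgen (k : ℤ) (hk : 1 ≤ k) : translate k u ∈ M := by
    refine Submodule.le_topologicalClosure _ (Submodule.subset_span ⟨(k - 1).toNat, ?_⟩)
    have : (((k - 1).toNat : ℕ) : ℤ) + 1 = k := by omega
    simp only [this]
  have hMtrans (k : ℤ) (hk : 0 ≤ k) : ∀ x ∈ M, translate k x ∈ M := by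
    have := hMle (M.comap (translate k).toLinearMap)
      (hMcl.preimage (translate k).continuous) (fun j => by
        change translate k (translate (j + 1) u) ∈ M
        rw [translate_translate]
        exact hgen _ (by omega))
    exact this
  have hMn₀ : ∀ x ∈ M, x n₀ = 0 := by
    have := hMle (LinearMap.ker (lp.evalCLM ℂ (fun _ : ℤ => ℂ) 2 n₀).toLinearMap)
      (ContinuousLinearMap.isClosed_ker _) (fun j => by
        change translate (j + 1) u n₀ = 0
        exact hlow _ (by omega))
    exact this
  set w := M.starProjection u with hw
  have hwM : w ∈ M := Submodule.starProjection_apply_mem _ _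
  set h := u - w with hh
  have hperp : ∀ x ∈ M, inner ℂ x h = 0 := fun x hx =>
    (Submodule.mem_orthogonal _ _).1 (Submodule.sub_starProjection_mem_orthogonal u) x hx
  have hh0 : h ≠ 0 := by
    intro hc
    apply hn₀
    have : h n₀ = u n₀ - w n₀ := rfl
    rw [hc, hMn₀ w hwM, sub_zero] at this
    exact this.symm
  have hortho (k : ℤ) (hk : 1 ≤ k) : inner ℂ (translate k h) h = 0 := by
    apply hperp
    rw [hh, map_sub]
    exact M.sub_mem (hgen k hk) (hMtrans k (by omega) w hwM)
  have hortho' (j k : ℤ) (hjk : j ≠ k) : inner ℂ (translate j h) (translate k h) = 0 := by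
    rcases lt_or_gt_of_ne hjk with hlt | hlt
    · rw [← inner_conj_symm, inner_translate_translate, hortho _ (by omega), map_zero]
    · rw [inner_translate_translate, hortho _ (by omega)]
  have hvh (k : ℤ) : inner ℂ v (translate k h) = 0 := by
    have hle := hMle (LinearMap.ker ((innerSL ℂ v).comp
        (translate k).toContinuousLinearMap).toLinearMap)
      (ContinuousLinearMap.isClosed_ker _) (fun j => by
        change inner ℂ v (translate k (translate (j + 1) u)) = 0
        rw [translate_translate, hv])
    have hvw : inner ℂ v (translate k w) = 0 := hle hwM
    rw [hh, map_sub, inner_sub_right, hv, hvw, sub_zero]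
  refine eq_zero_of_inner_translate_eq_zero (h := ((‖h‖⁻¹ : ℝ) : ℂ) • h) ⟨fun k => ?_, ?_⟩ ?_
  · rw [LinearIsometry.norm_map, norm_smul]
    simp [hh0]
  · intro j k hjk
    simp only [map_smul, inner_smul_left, inner_smul_right, hortho' j k hjk, mul_zero]
  · intro k
    rw [map_smul, inner_smul_right, hvh, mul_zero]

/-- If all coefficients of the convolution `u * v` of two square summable sequences vanish and `u`
is one-sided, then `u` or `v` vanishes: a nonzero function of the Hardy space of the circle is
nonzero almost everywhere. -/
theorem eq_zero_or_eq_zero_of_convolution_eq_zero {u v : ℤ → ℂ}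
    (hu2 : Summable fun n => ‖u n‖ ^ 2) (hv2 : Summable fun n => ‖v n‖ ^ 2)
    (hu : ∀ n < 0, u n = 0) (huv : ∀ N : ℤ, ∑' n, u (N - n) * v n = 0) : u = 0 ∨ v = 0 := by
  by_cases hu0 : u = 0
  · exact Or.inl hu0
  right
  have hv2' : Summable fun n => ‖star (v (-n))‖ ^ 2 := by
    simp only [norm_star]
    exact (Equiv.neg ℤ).summable_iff.2 hv2
  let U : lp (fun _ : ℤ => ℂ) 2 := ⟨u, memℓp_two_of_summable hu2⟩
  let V : lp (fun _ : ℤ => ℂ) 2 := ⟨fun n => star (v (-n)), memℓp_two_of_summable hv2'⟩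
  have hV : V = 0 := by
    refine eq_zero_of_inner_translate_oneSided (u := U) hu (fun hc => hu0 ?_) fun k => ?_
    · funext n
      exact congrFun (congrArg Subtype.val hc) n
    · rw [lp.inner_eq_tsum, ← huv (-k), ← (Equiv.neg ℤ).tsum_eq]
      refine tsum_congr fun n => ?_
      change u (-n - k) * star (star (v (- -n))) = _
      rw [star_star, neg_neg, show -n - k = -k - n by ring]
  funext n
  have : star (v (- -n)) = 0 := congrFun (congrArg Subtype.val hV) (-n)
  simpa using this

/-! ### Entries of commutators of Toeplitz matrices on the quadrant -/

/-- The nonnegative quadrant of `ℤ²`: the frequencies of the analytic monomials. -/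
def quadrant : Set (ℤ × ℤ) := {l | 0 ≤ l.1 ∧ 0 ≤ l.2}

/-- The summand `a (p - l) * b (l - q)` of the `(p, q)` entry of the product of the two Laurent
matrices with symbols `a` and `b`. -/
def laurentTerm (a b : ℤ × ℤ → ℂ) (p q l : ℤ × ℤ) : ℂ := a (p - l) * b (l - q)

/-- The `(p, q)` entry of the commutator of the Toeplitz matrices with symbols `a` and `b`, that is,
of the compressions of the Laurent matrices to the quadrant. -/
def commutatorEntry (a b : ℤ × ℤ → ℂ) (p q : ℤ × ℤ) : ℂ :=
  ∑' l, quadrant.indicator (fun l => laurentTerm a b p q l - laurentTerm b a p q l) l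

section Entries

variable {a b : ℤ × ℤ → ℂ}

theorem summable_laurentTerm (ha : Summable fun l => ‖a l‖ ^ 2) (hb : Summable fun l => ‖b l‖ ^ 2)
    (p q : ℤ × ℤ) : Summable (laurentTerm a b p q) := by
  refine Summable.of_norm_bounded
    (((Equiv.subLeft p).summable_iff.2 ha).add ((Equiv.subRight q).summable_iff.2 hb)) fun l => ?_
  simp only [laurentTerm, norm_mul, Function.comp_apply, Equiv.subLeft_apply, Equiv.subRight_apply]
  nlinarith [sq_nonneg (‖a (p - l)‖ - ‖b (l - q)‖), sq_nonneg ‖a (p - l)‖, sq_nonneg ‖b (l - q)‖]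

theorem tsum_indicator_laurentTerm_add (S : Set (ℤ × ℤ)) (p q d : ℤ × ℤ) :
    ∑' l, S.indicator (laurentTerm a b (p + d) (q + d)) l =
      ∑' l, {l | l + d ∈ S}.indicator (laurentTerm a b p q) l := by
  rw [← (Equiv.addRight d).tsum_eq]
  refine tsum_congr fun l => ?_
  have h : laurentTerm a b (p + d) (q + d) (l + d) = laurentTerm a b p q l := by
    simp [laurentTerm]
  by_cases hl : l + d ∈ S <;> simp [hl, h]

theorem tsum_laurentTerm_comm (p q : ℤ × ℤ) :
    ∑' l, laurentTerm b a p q l = ∑' l, laurentTerm a b p q l := by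
  rw [← (Equiv.subLeft (p + q)).tsum_eq]
  refine tsum_congr fun l => ?_
  simp only [laurentTerm, Equiv.subLeft_apply]
  rw [show p - (p + q - l) = l - q by abel, show p + q - l - q = p - l by abel, mul_comm]

/-- For an analytic symbol `a` one has `T_b T_a = T_{ab}`, so the commutator is, up to sign, the
semicommutator `T_{ab} - T_a T_b`, whose entries sum over the complement of the quadrant. -/
theorem commutatorEntry_eq_neg_tsum (ha : Summable fun l => ‖a l‖ ^ 2)
    (hb : Summable fun l => ‖b l‖ ^ 2) (han : ∀ l ∉ quadrant, a l = 0) {q : ℤ × ℤ}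
    (hq : q ∈ quadrant) (p : ℤ × ℤ) :
    commutatorEntry a b p q = -∑' l, quadrantᶜ.indicator (laurentTerm a b p q) l := by
  have hφ := summable_laurentTerm ha hb p q
  have hψ : quadrant.indicator (laurentTerm b a p q) = laurentTerm b a p q := by
    refine Set.indicator_eq_self.2 fun l hl => ?_
    by_contra hc
    refine hl (mul_eq_zero_of_right _ (han _ fun h => hc ?_))
    simp only [quadrant, Set.mem_ofPred_eq, Prod.fst_sub, Prod.snd_sub] at h hq ⊢
    omega
  have h1 : ∑' l, laurentTerm a b p q l = ∑' l, quadrant.indicator (laurentTerm a b p q) l +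
      ∑' l, quadrantᶜ.indicator (laurentTerm a b p q) l := by
    rw [← (hφ.indicator _).tsum_add (hφ.indicator _)]
    exact tsum_congr fun l => (Set.indicator_self_add_compl_apply _ _ _).symm
  have h2 : commutatorEntry a b p q = ∑' l, quadrant.indicator (laurentTerm a b p q) l -
      ∑' l, laurentTerm b a p q l := by
    rw [← (hφ.indicator _).tsum_sub (summable_laurentTerm hb ha p q)]
    refine tsum_congr fun l => ?_
    conv_rhs => rw [← hψ]
    exact congrFun (Set.indicator_sub _ _ _) l
  rw [h2, tsum_laurentTerm_comm, h1]
  ring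

theorem add_mem_quadrant {p : ℤ × ℤ} (hp : p ∈ quadrant) {m n : ℤ} (hm : 0 ≤ m) (hn : 0 ≤ n) :
    p + (m, n) ∈ quadrant := by
  simp only [quadrant, Set.mem_ofPred_eq, Prod.fst_add, Prod.snd_add] at hp ⊢
  omega

/-- Moving one step along the diagonal in the second variable changes the entry by the terms of
the half row `l₂ = -1`, `l₁ ≥ 0`; after a preliminary shift by `k` in the first variable, by those
with `l₁ ≥ -k`. -/
theorem commutatorEntry_add_sub (ha : Summable fun l => ‖a l‖ ^ 2)
    (hb : Summable fun l => ‖b l‖ ^ 2) (han : ∀ l ∉ quadrant, a l = 0) {p q : ℤ × ℤ}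
    (hq : q ∈ quadrant) {k : ℤ} (hk : 0 ≤ k) :
    commutatorEntry a b (p + (k, 1)) (q + (k, 1)) - commutatorEntry a b (p + (k, 0)) (q + (k, 0)) =
      ∑' l, {l : ℤ × ℤ | -k ≤ l.1 ∧ l.2 = -1}.indicator (laurentTerm a b p q) l := by
  have hφ := summable_laurentTerm ha hb p q
  rw [commutatorEntry_eq_neg_tsum ha hb han (add_mem_quadrant hq hk zero_le_one),
    commutatorEntry_eq_neg_tsum ha hb han (add_mem_quadrant hq hk le_rfl),
    tsum_indicator_laurentTerm_add, tsum_indicator_laurentTerm_add, neg_sub_neg,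
    ← (hφ.indicator _).tsum_sub (hφ.indicator _)]
  refine tsum_congr fun l => ?_
  simp only [Set.indicator_apply, quadrant, Set.mem_ofPred_eq, Set.mem_compl_iff, Prod.fst_add,
    Prod.snd_add]
  split_ifs <;> first | omega | simp

theorem tsum_row_eq_zero (ha : Summable fun l => ‖a l‖ ^ 2)
    (hb : Summable fun l => ‖b l‖ ^ 2) (han : ∀ l ∉ quadrant, a l = 0)
    (hlim : ∀ p ∈ quadrant, ∀ q ∈ quadrant,
      Tendsto (fun k : ℕ => commutatorEntry a b (p + ((k : ℤ), 0)) (q + ((k : ℤ), 0)))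
        atTop (𝓝 0))
    {p q : ℤ × ℤ} (hp : p ∈ quadrant) (hq : q ∈ quadrant) :
    ∑' n : ℤ, laurentTerm a b p q (n, -1) = 0 := by
  have hφ := summable_laurentTerm ha hb p q
  set R : Set (ℤ × ℤ) := {l | l.2 = -1} with hR
  have hrow : ∑' n : ℤ, laurentTerm a b p q (n, -1) =
      ∑' l, R.indicator (laurentTerm a b p q) l := by
    have hinj : Function.Injective fun n : ℤ => ((n, -1) : ℤ × ℤ) := fun m n h =>
      congrArg Prod.fst h
    rw [← hinj.tsum_eq (f := R.indicator (laurentTerm a b p q))]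
    · exact tsum_congr fun n => (Set.indicator_of_mem (by simp [hR]) _).symm
    · intro l hl
      have : l ∈ R := Set.mem_of_indicator_ne_zero hl
      exact ⟨l.1, Prod.ext rfl this.symm⟩
  rw [hrow]
  have h1 : Tendsto (fun k : ℕ => ∑' l, {l : ℤ × ℤ | -(k : ℤ) ≤ l.1 ∧ l.2 = -1}.indicator
      (laurentTerm a b p q) l) atTop (𝓝 (∑' l, R.indicator (laurentTerm a b p q) l)) := by
    refine tendsto_tsum_of_dominated_convergence hφ.norm (fun l => ?_)
      (Eventually.of_forall fun k l => norm_indicator_le_norm_self _ _)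
    refine tendsto_const_nhds.congr' ?_
    filter_upwards [eventually_ge_atTop (-l.1).toNat] with k hk
    have : -(k : ℤ) ≤ l.1 := by omega
    simp [Set.indicator_apply, hR, this]
  refine tendsto_nhds_unique h1 ?_
  have h2 := (hlim _ (add_mem_quadrant hp le_rfl zero_le_one) _
    (add_mem_quadrant hq le_rfl zero_le_one)).sub (hlim p hp q hq)
  rw [sub_zero] at h2
  refine h2.congr fun k => ?_
  rw [← commutatorEntry_add_sub ha hb han hq (Int.natCast_nonneg k)]
  simp [add_assoc]

/-- Entries tending to zero along the diagonals in the first variable force, in the second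
variable, either `a` to be constant or `b` to be analytic. -/
theorem row_alternative (ha : Summable fun l => ‖a l‖ ^ 2)
    (hb : Summable fun l => ‖b l‖ ^ 2) (han : ∀ l ∉ quadrant, a l = 0)
    (hlim : ∀ p ∈ quadrant, ∀ q ∈ quadrant,
      Tendsto (fun k : ℕ => commutatorEntry a b (p + ((k : ℤ), 0)) (q + ((k : ℤ), 0)))
        atTop (𝓝 0)) :
    (∀ m i : ℤ, 0 < i → a (m, i) = 0) ∨ ∀ m j : ℤ, j < 0 → b (m, j) = 0 := by
  by_contra! hc
  obtain ⟨⟨m, i, hi, hmi⟩, m', j, hj, hmj⟩ := hc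
  have hinj (i : ℤ) : Function.Injective fun n : ℤ => ((n, i) : ℤ × ℤ) := fun m n h =>
    congrArg Prod.fst h
  have hconv (N : ℤ) : ∑' n, a (N - n, i) * b (n, j) = 0 := by
    -- The entry with `p = (N⁺, i - 1)` and `q = (N⁻, -1 - j)` carries this convolution coefficient.
    have hrow := tsum_row_eq_zero ha hb han hlim (p := (max N 0, i - 1)) (q := (max (-N) 0, -1 - j))
      ⟨le_max_right _ _, by simp only; omega⟩ ⟨le_max_right _ _, by simp only; omega⟩
    rw [← hrow, ← (Equiv.subRight (max (-N) 0)).tsum_eq]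
    refine tsum_congr fun n => ?_
    simp only [laurentTerm, Equiv.subRight_apply, Prod.mk_sub_mk]
    congr 3 <;> omega
  rcases eq_zero_or_eq_zero_of_convolution_eq_zero (u := fun n => a (n, i)) (v := fun n => b (n, j))
    (ha.comp_injective (hinj i)) (hb.comp_injective (hinj j))
    (fun n hn => han _ fun h => absurd h.1 (not_le.2 hn)) hconv with h | h
  · exact hmi (congrFun h m)
  · exact hmj (congrFun h m')

theorem commutatorEntry_comp_swap (p q : ℤ × ℤ) :
    commutatorEntry (a ∘ Prod.swap) (b ∘ Prod.swap) p q = commutatorEntry a b p.swap q.swap := by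
  unfold commutatorEntry
  conv_rhs => rw [← (Equiv.prodComm ℤ ℤ).tsum_eq]
  refine tsum_congr fun l => ?_
  simp [Set.indicator_apply, quadrant, laurentTerm, and_comm]

/-- The decay of the entries along the diagonals of the quadrant, in either variable: all that is
used of the compactness of the commutator. -/
def DiagonalDecay (a b : ℤ × ℤ → ℂ) : Prop :=
  ∀ p ∈ quadrant, ∀ q ∈ quadrant,
    Tendsto (fun k : ℕ => commutatorEntry a b (p + ((k : ℤ), 0)) (q + ((k : ℤ), 0))) atTop (𝓝 0) ∧
    Tendsto (fun k : ℕ => commutatorEntry a b (p + (0, (k : ℤ))) (q + (0, (k : ℤ)))) atTop (𝓝 0)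

theorem commutatorEntry_eq_zero_of_analytic (ha : Summable fun l => ‖a l‖ ^ 2)
    (hb : Summable fun l => ‖b l‖ ^ 2) (han : ∀ l ∉ quadrant, a l = 0)
    (hlim : DiagonalDecay a b) {p q : ℤ × ℤ} (hp : p ∈ quadrant) (hq : q ∈ quadrant) :
    commutatorEntry a b p q = 0 := by
  have hswap (l : ℤ × ℤ) : l.swap ∈ quadrant ↔ l ∈ quadrant := and_comm
  have h2 := row_alternative ha hb han fun p hp q hq => (hlim p hp q hq).1
  have h1 := row_alternative (a := a ∘ Prod.swap) (b := b ∘ Prod.swap)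
    ((Equiv.prodComm ℤ ℤ).summable_iff.2 ha) ((Equiv.prodComm ℤ ℤ).summable_iff.2 hb)
    (fun l hl => han _ (by rwa [hswap])) (fun p hp q hq => by
      simp only [commutatorEntry_comp_swap]
      exact (hlim p.swap ((hswap p).2 hp) q.swap ((hswap q).2 hq)).2)
  rw [commutatorEntry_eq_neg_tsum ha hb han hq, neg_eq_zero]
  refine (tsum_congr fun l => ?_).trans tsum_zero
  refine Set.indicator_apply_eq_zero.2 fun hl => ?_
  have hl' : l.1 < 0 ∨ l.2 < 0 := by
    by_contra! hc
    exact hl hc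
  rcases hl' with hl' | hl'
  · rcases h1 with h1 | h1
    · exact mul_eq_zero_of_left (h1 (p - l).2 (p - l).1 (by have := hp.1; simp; omega)) _
    · exact mul_eq_zero_of_right _ (h1 (l - q).2 (l - q).1 (by have := hq.1; simp; omega))
  · rcases h2 with h2 | h2
    · exact mul_eq_zero_of_left (h2 (p - l).1 (p - l).2 (by have := hp.2; simp; omega)) _
    · exact mul_eq_zero_of_right _ (h2 (l - q).1 (l - q).2 (by have := hq.2; simp; omega))

theorem commutatorEntry_swap (p q : ℤ × ℤ) : commutatorEntry b a p q = -commutatorEntry a b p q := by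
  unfold commutatorEntry
  rw [← tsum_neg]
  refine tsum_congr fun l => ?_
  by_cases hl : l ∈ quadrant <;> simp [hl]

/-- The sequence of Fourier coefficients of the complex conjugate of a function with coefficient
sequence `a`. -/
def conjCoeff (a : ℤ × ℤ → ℂ) (l : ℤ × ℤ) : ℂ := star (a (-l))

theorem summable_conjCoeff (ha : Summable fun l => ‖a l‖ ^ 2) :
    Summable fun l => ‖conjCoeff a l‖ ^ 2 := by
  simp only [conjCoeff, norm_star]
  exact (Equiv.neg (ℤ × ℤ)).summable_iff.2 ha

/-- The adjoint of the commutator is the negative of the commutator of the conjugate symbols. -/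
theorem commutatorEntry_conjCoeff (p q : ℤ × ℤ) :
    commutatorEntry (conjCoeff a) (conjCoeff b) p q = -star (commutatorEntry a b q p) := by
  unfold commutatorEntry
  rw [tsum_star, ← tsum_neg]
  refine tsum_congr fun l => ?_
  by_cases hl : l ∈ quadrant
  · simp only [hl, Set.indicator_of_mem, laurentTerm, conjCoeff, star_sub, star_mul', neg_sub]
    ring
  · simp [hl]

theorem DiagonalDecay.symm (h : DiagonalDecay a b) : DiagonalDecay b a := fun p hp q hq => by
  simp only [commutatorEntry_swap (a := a) (b := b)]
  exact ⟨by simpa using (h p hp q hq).1.neg, by simpa using (h p hp q hq).2.neg⟩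

theorem DiagonalDecay.conjCoeff (h : DiagonalDecay a b) :
    DiagonalDecay (conjCoeff a) (conjCoeff b) := fun p hp q hq => by
  simp only [commutatorEntry_conjCoeff]
  exact ⟨by simpa using (h q hq p hp).1.star.neg, by simpa using (h q hq p hp).2.star.neg⟩

/-- Passing to the adjoint and exchanging the symbols reduce the four cases to that of an analytic
first symbol. -/
theorem commutatorEntry_eq_zero (ha : Summable fun l => ‖a l‖ ^ 2)
    (hb : Summable fun l => ‖b l‖ ^ 2)
    (han : (∀ l ∉ quadrant, a l = 0) ∨ (∀ l ∉ quadrant, conjCoeff a l = 0) ∨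
      (∀ l ∉ quadrant, b l = 0) ∨ ∀ l ∉ quadrant, conjCoeff b l = 0)
    (hlim : DiagonalDecay a b) {p q : ℤ × ℤ} (hp : p ∈ quadrant) (hq : q ∈ quadrant) :
    commutatorEntry a b p q = 0 := by
  rcases han with h | h | h | h
  · exact commutatorEntry_eq_zero_of_analytic ha hb h hlim hp hq
  · have := commutatorEntry_eq_zero_of_analytic (summable_conjCoeff ha) (summable_conjCoeff hb) h
      hlim.conjCoeff hq hp
    simpa [commutatorEntry_conjCoeff] using this
  · have := commutatorEntry_eq_zero_of_analytic hb ha h hlim.symm hp hq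
    simpa [commutatorEntry_swap (a := a) (b := b)] using this
  · have := commutatorEntry_eq_zero_of_analytic (summable_conjCoeff hb) (summable_conjCoeff ha) h
      hlim.symm.conjCoeff hq hp
    simpa [commutatorEntry_conjCoeff, commutatorEntry_swap (a := a) (b := b)] using this

end Entries

/-! ### Fourier coefficients and the matrix of the commutator -/

/-- The character `z₁^{l₁} z₂^{l₂}` of the torus, `l ∈ ℤ²`, as an element of `L²`. -/
def mode (l : ℤ × ℤ) : L2 :=
  ContinuousMap.toLp (E := ℂ) 2 σ ℂ (UnitAddTorus.mFourier ![l.1, l.2])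

theorem mode_eq_mFourierLp :
    mode = (UnitAddTorus.mFourierLp 2 : (Fin 2 → ℤ) → L2) ∘ (finTwoArrowEquiv ℤ).symm := by
  funext l
  rfl

theorem coeFn_mode (l : ℤ × ℤ) : mode l =ᵐ[σ] UnitAddTorus.mFourier ![l.1, l.2] :=
  ContinuousMap.coeFn_toLp σ _

theorem orthonormal_mode : Orthonormal ℂ mode := by
  rw [mode_eq_mFourierLp]
  exact UnitAddTorus.orthonormal_mFourier.comp _ (finTwoArrowEquiv ℤ).symm.injective

/-- The Fourier basis of `L²(T²)`, indexed by pairs of integers. -/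
def modeBasis : HilbertBasis (ℤ × ℤ) ℂ L2 :=
  HilbertBasis.mk orthonormal_mode (by
    rw [mode_eq_mFourierLp, (finTwoArrowEquiv ℤ).symm.surjective.range_comp]
    exact (UnitAddTorus.span_mFourierLp_closure_eq_top (by simp)).ge)

@[simp]
theorem coe_modeBasis : ⇑modeBasis = mode := HilbertBasis.coe_mk _ _

theorem eq_zero_of_inner_mode_eq_zero {x : L2} (h : ∀ l, inner ℂ (mode l) x = 0) : x = 0 := by
  apply modeBasis.repr.injective
  ext l
  rw [modeBasis.repr_apply_apply, coe_modeBasis, h, map_zero]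
  rfl

theorem inner_mulOp_star (f : LInf) (x y : L2) :
    inner ℂ (mulOp (star f) x) y = inner ℂ x (mulOp f y) := by
  rw [L2.inner_def, L2.inner_def]
  refine integral_congr_ae ?_
  filter_upwards [coeFn_mulOp (star f) x, coeFn_mulOp f y, Lp.coeFn_star f] with t h1 h2 h3
  rw [h1, h2, h3]
  simp only [RCLike.inner_apply, Pi.star_apply, map_mul, RCLike.star_def, RCLike.conj_conj]
  ring

/-- The Fourier coefficients of a bounded function. Since `mode 0 = 1`, the vector
`mulOp f (mode 0)` is `f` as an element of `L²`. -/
def coeff (f : LInf) (l : ℤ × ℤ) : ℂ := inner ℂ (mode l) (mulOp f (mode 0))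

theorem inner_mode_mulOp_mode (f : LInf) (p q : ℤ × ℤ) :
    inner ℂ (mode p) (mulOp f (mode q)) = coeff f (p - q) := by
  rw [coeff, L2.inner_def, L2.inner_def]
  refine integral_congr_ae ?_
  filter_upwards [coeFn_mulOp f (mode q), coeFn_mulOp f (mode 0), coeFn_mode p, coeFn_mode q,
    coeFn_mode 0, coeFn_mode (p - q)] with t h1 h2 h3 h4 h5 h6
  rw [h1, h2, h3, h4, h5, h6]
  have e1 : (![(p - q).1, (p - q).2] : Fin 2 → ℤ) = ![p.1, p.2] + -![q.1, q.2] := by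
    ext i; fin_cases i <;> simp [sub_eq_add_neg]
  have e2 : (![(0 : ℤ × ℤ).1, (0 : ℤ × ℤ).2] : Fin 2 → ℤ) = 0 := by
    ext i; fin_cases i <;> rfl
  rw [e1, e2, UnitAddTorus.mFourier_add, UnitAddTorus.mFourier_neg, UnitAddTorus.mFourier_zero]
  simp only [RCLike.inner_apply, map_mul, RCLike.conj_conj, ContinuousMap.one_apply]
  ring

theorem summable_coeff (f : LInf) : Summable fun l => ‖coeff f l‖ ^ 2 := by
  have := summable_norm_sq (modeBasis.repr (mulOp f (mode 0)))
  simpa only [modeBasis.repr_apply_apply, coe_modeBasis, coeff] using this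

theorem coeff_star (f : LInf) : coeff (star f) = conjCoeff (coeff f) := by
  funext l
  rw [coeff, ← inner_conj_symm, inner_mulOp_star, inner_mode_mulOp_mode, zero_sub]
  rfl

theorem hasSum_inner_mode_mulOp (f : LInf) (p : ℤ × ℤ) (x : L2) :
    HasSum (fun l => coeff f (p - l) * inner ℂ (mode l) x) (inner ℂ (mode p) (mulOp f x)) := by
  have := modeBasis.hasSum_inner_mul_inner (mulOp (star f) (mode p)) x
  simpa only [coe_modeBasis, inner_mulOp_star, inner_mode_mulOp_mode] using this

theorem monomialL2_eq_mode (m : Fin 2 → ℕ) : monomialL2 m = mode ((m 0 : ℤ), (m 1 : ℤ)) := by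
  have : (fun i => (m i : ℤ)) = ![(m 0 : ℤ), (m 1 : ℤ)] := by
    ext i; fin_cases i <;> rfl
  rw [monomialL2, monomialFun, this, mode]

theorem mode_mem_H2 {l : ℤ × ℤ} (hl : l ∈ quadrant) : mode l ∈ H2 := by
  refine Submodule.le_topologicalClosure _ (Submodule.subset_span ⟨![l.1.toNat, l.2.toNat], ?_⟩)
  rw [monomialL2_eq_mode]
  congr 1
  exact Prod.ext (Int.toNat_of_nonneg hl.1) (Int.toNat_of_nonneg hl.2)

theorem inner_mode_eq_zero {l : ℤ × ℤ} (hl : l ∉ quadrant) {x : L2} (hx : x ∈ H2) :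
    inner ℂ (mode l) x = 0 := by
  have hle : H2 ≤ LinearMap.ker (innerSL ℂ (mode l)).toLinearMap := by
    refine Submodule.topologicalClosure_minimal _ (Submodule.span_le.2 ?_)
      (ContinuousLinearMap.isClosed_ker _)
    rintro _ ⟨m, rfl⟩
    change inner ℂ (mode l) (monomialL2 m) = 0
    rw [monomialL2_eq_mode]
    refine orthonormal_mode.2 ?_
    rintro rfl
    exact hl ⟨Int.natCast_nonneg _, Int.natCast_nonneg _⟩
  exact hle hx

theorem coeff_eq_zero_of_isAnalytic {f : LInf} (hf : IsAnalytic f) {l : ℤ × ℤ}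
    (hl : l ∉ quadrant) : coeff f l = 0 := by
  have : mulOp f (mode 0) = ((Lp.memLp f).mono_exponent le_top : MemLp f 2 σ).toLp f := by
    refine Lp.ext ?_
    filter_upwards [coeFn_mulOp f (mode 0), coeFn_mode 0,
      ((Lp.memLp f).mono_exponent le_top : MemLp f 2 σ).coeFn_toLp] with t h1 h2 h3
    have e2 : (![(0 : ℤ × ℤ).1, (0 : ℤ × ℤ).2] : Fin 2 → ℤ) = 0 := by
      ext i; fin_cases i <;> rfl
    rw [h1, h2, h3, e2, UnitAddTorus.mFourier_zero, ContinuousMap.one_apply, mul_one]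
  rw [coeff, this]
  exact inner_mode_eq_zero hl hf

/-- The vectors `mode l`, for `l` in the quadrant, as elements of the Hardy space. -/
def hardyMode (l : quadrant) : H2 := ⟨mode l, mode_mem_H2 l.2⟩

theorem orthonormal_hardyMode : Orthonormal ℂ hardyMode := by
  have := orthonormal_mode.comp _ (Subtype.val_injective (p := (· ∈ quadrant)))
  exact ⟨fun l => this.1 l, fun j k hjk => this.2 hjk⟩

theorem inner_mode_projection (l : ℤ × ℤ) (x : L2) :
    inner ℂ (mode l) (H2.orthogonalProjectionOnto x : L2) =
      quadrant.indicator (fun l => inner ℂ (mode l) x) l := by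
  by_cases hl : l ∈ quadrant
  · rw [Set.indicator_of_mem hl]
    exact (H2.inner_orthogonalProjectionOnto_eq_of_mem_left ⟨mode l, mode_mem_H2 hl⟩ x)
  · rw [Set.indicator_of_notMem hl, inner_mode_eq_zero hl (Subtype.mem _)]

theorem hasSum_inner_hardyMode_toeplitz_comp (f g : LInf) (p q : quadrant) :
    HasSum (quadrant.indicator (laurentTerm (coeff f) (coeff g) p q))
      (inner ℂ (hardyMode p) ((toeplitz f ∘L toeplitz g) (hardyMode q))) := by
  have h := hasSum_inner_mode_mulOp f p (H2.orthogonalProjectionOnto (mulOp g (mode q)) : L2)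
  have h2 : inner ℂ (hardyMode p) ((toeplitz f ∘L toeplitz g) (hardyMode q)) =
      inner ℂ (mode p) (mulOp f (H2.orthogonalProjectionOnto (mulOp g (mode q)) : L2)) :=
    H2.inner_orthogonalProjectionOnto_eq_of_mem_left (hardyMode p) _
  rw [h2]
  convert h using 1
  funext l
  rw [inner_mode_projection]
  by_cases hl : l ∈ quadrant <;> simp [hl, laurentTerm, inner_mode_mulOp_mode]

theorem inner_hardyMode_commutator (f g : LInf) (p q : quadrant) :
    inner ℂ (hardyMode p)
      ((toeplitz f ∘L toeplitz g - toeplitz g ∘L toeplitz f) (hardyMode q)) =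
      commutatorEntry (coeff f) (coeff g) p q := by
  rw [sub_apply, inner_sub_right]
  rw [← ((hasSum_inner_hardyMode_toeplitz_comp f g p q).sub
    (hasSum_inner_hardyMode_toeplitz_comp g f p q)).tsum_eq]
  exact tsum_congr fun l => (congrFun (Set.indicator_sub _ _ _) l).symm

/-- An operator on the Hardy space is determined by its matrix. -/
theorem eq_zero_of_inner_hardyMode_eq_zero {A : H2 →L[ℂ] H2}
    (h : ∀ p q, inner ℂ (hardyMode p) (A (hardyMode q)) = 0) : A = 0 := by
  ext1 x
  apply Subtype.ext
  refine eq_zero_of_inner_mode_eq_zero fun p => ?_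
  by_cases hp : p ∈ quadrant
  swap
  · exact inner_mode_eq_zero hp (Subtype.mem _)
  have h1 : inner ℂ (mode p) (A x : L2) =
      inner ℂ ((A.adjoint (hardyMode ⟨p, hp⟩) : H2) : L2) (x : L2) :=
    (A.adjoint_inner_left x (hardyMode ⟨p, hp⟩)).symm
  rw [h1, ← modeBasis.tsum_inner_mul_inner]
  refine (tsum_congr fun q => ?_).trans tsum_zero
  rw [coe_modeBasis]
  by_cases hq : q ∈ quadrant
  · refine mul_eq_zero_of_left ?_ _
    exact (A.adjoint_inner_left (hardyMode ⟨q, hq⟩) (hardyMode ⟨p, hp⟩)).trans (h _ _)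
  · rw [inner_mode_eq_zero hq (Subtype.mem x), mul_zero]

/-! ### Compact operators -/

/-- An orthonormal sequence tends weakly to zero, by Bessel's inequality. -/
theorem tendsto_inner_orthonormal {E : Type*} [NormedAddCommGroup E] [InnerProductSpace ℂ E]
    {y : ℕ → E} (hy : Orthonormal ℂ y) (v : E) :
    Tendsto (fun n => inner ℂ (y n) v) atTop (𝓝 0) := by
  have h1 := (hy.inner_products_summable v).tendsto_atTop_zero
  rw [tendsto_zero_iff_norm_tendsto_zero]
  have h2 := h1.sqrt
  simpa using h2

/-- The matrix coefficients of a compact operator tend to zero along any bounded sequence of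
arguments and any orthonormal sequence of test vectors. -/
theorem tendsto_inner_of_isCompactOperator {E : Type*} [NormedAddCommGroup E]
    [InnerProductSpace ℂ E] {A : E →L[ℂ] E} (hA : IsCompactOperator A) {x y : ℕ → E}
    (hx : ∀ n, ‖x n‖ ≤ 1) (hy : Orthonormal ℂ y) :
    Tendsto (fun n => inner ℂ (y n) (A (x n))) atTop (𝓝 0) := by
  obtain ⟨K, hK, hAK⟩ := hA.image_closedBall_subset_compact (f := (A : E →ₗ[ℂ] E)) 1
  refine tendsto_of_subseq_tendsto fun ns hns => ?_
  obtain ⟨v, -, φ, hφ, hlim⟩ := hK.tendsto_subseq (x := fun n => A (x (ns n)))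
    fun n => hAK ⟨x (ns n), by simpa using hx _, rfl⟩
  refine ⟨φ, ?_⟩
  have h1 : Tendsto (fun n => inner ℂ (y (ns (φ n))) v) atTop (𝓝 0) :=
    (tendsto_inner_orthonormal hy v).comp (hns.comp hφ.tendsto_atTop)
  have h2 : Tendsto (fun n => inner ℂ (y (ns (φ n))) (A (x (ns (φ n))) - v)) atTop (𝓝 0) := by
    refine squeeze_zero_norm (fun n => ?_) (tendsto_iff_norm_sub_tendsto_zero.1 hlim)
    refine (norm_inner_le_norm _ _).trans ?_
    rw [hy.1, one_mul]
    rfl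
  have h3 := h1.add h2
  rw [add_zero] at h3
  refine h3.congr fun n => ?_
  rw [← inner_add_right, add_sub_cancel]

theorem diagonalDecay_of_isCompactOperator {f g : LInf}
    (h : IsCompactOperator (toeplitz f ∘L toeplitz g - toeplitz g ∘L toeplitz f)) :
    DiagonalDecay (coeff f) (coeff g) := by
  have hentry := inner_hardyMode_commutator f g
  generalize toeplitz f ∘L toeplitz g - toeplitz g ∘L toeplitz f = A at h hentry
  have key (d : ℕ → ℤ × ℤ) (hd : Function.Injective d)
      (hdq : ∀ k, ∀ p ∈ quadrant, p + d k ∈ quadrant) (p q : ℤ × ℤ) (hp : p ∈ quadrant)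
      (hq : q ∈ quadrant) :
      Tendsto (fun k => commutatorEntry (coeff f) (coeff g) (p + d k) (q + d k)) atTop (𝓝 0) := by
    have hy : Orthonormal ℂ fun k => hardyMode ⟨p + d k, hdq k p hp⟩ :=
      orthonormal_hardyMode.comp (fun k => ⟨p + d k, hdq k p hp⟩) fun j k hjk =>
        hd (add_left_cancel (congrArg Subtype.val hjk))
    have hlim := tendsto_inner_of_isCompactOperator h
      (x := fun k => hardyMode ⟨q + d k, hdq k q hq⟩) (fun k => (orthonormal_hardyMode.1 _).le) hy
    simpa only [hentry] using hlim
  intro p hp q hq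
  constructor
  · exact key (fun k => ((k : ℤ), 0)) (fun j k h => by simpa using h)
      (fun k p hp => add_mem_quadrant hp (Int.natCast_nonneg k) le_rfl) p q hp hq
  · exact key (fun k => (0, (k : ℤ))) (fun j k h => by simpa using h)
      (fun k p hp => add_mem_quadrant hp le_rfl (Int.natCast_nonneg k)) p q hp hq

end Bidisc

end


theorem corollary2 (f g : Bidisc.LInf)
    (h : Bidisc.IsAnalytic f ∨ Bidisc.IsAnalytic (star f) ∨
      Bidisc.IsAnalytic g ∨ Bidisc.IsAnalytic (star g)) :
    Bidisc.toeplitz f ∘L Bidisc.toeplitz g - Bidisc.toeplitz g ∘L Bidisc.toeplitz f = 0 ↔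
      IsCompactOperator
        (Bidisc.toeplitz f ∘L Bidisc.toeplitz g - Bidisc.toeplitz g ∘L Bidisc.toeplitz f) := by
  refine ⟨fun h0 => h0 ▸ isCompactOperator_zero, fun hc => ?_⟩
  refine Bidisc.eq_zero_of_inner_hardyMode_eq_zero fun p q => ?_
  rw [Bidisc.inner_hardyMode_commutator]
  refine Bidisc.commutatorEntry_eq_zero (Bidisc.summable_coeff f) (Bidisc.summable_coeff g) ?_
    (Bidisc.diagonalDecay_of_isCompactOperator hc) p.2 q.2
  simp only [← Bidisc.coeff_star]
  exact h.imp (fun h _ => Bidisc.coeff_eq_zero_of_isAnalytic h) <|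
    Or.imp (fun h _ => Bidisc.coeff_eq_zero_of_isAnalytic h) <|
    Or.imp (fun h _ => Bidisc.coeff_eq_zero_of_isAnalytic h)
      (fun h _ => Bidisc.coeff_eq_zero_of_isAnalytic h)
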